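/- **Theorem 2.** Let $\alpha>-1$, $\nu\ge 0$, and let $\rho_\nu(x)=2x^{\nu/2}K_\nu(2\sqrt x)$ for $x>0$, where $K_\nu(z)=\int_0^\infty e^{-z\cosh u}\cosh(\nu u)\,du$ is the modified Bessel function of the second kind; for $\nu>0$ put $\rho_\nu(0)=\lim_{x\to0+}\rho_\nu(x)=\Gamma(\nu)$. For $\lambda,t\ge 0$ with $\lambda^2+t^2\ne 0$ (and $t>0$ if $\nu=0$), let $P_n(x)=P_n(x;\lambda,t)=a_nx^n+\dots$, $a_n=a_n(\lambda,t)>0$, $n=0,1,2,\dots$, be the orthonormal polynomials for the weight $x^\alpha e^{-\lambda x}\rho_\nu(xt)$ on $(0,\infty)$, that is, $\deg P_n=n$ and $$\int_0^\infty P_m(x;\lambda,t)\,P_n(x;\lambda,t)\,x^\alpha e^{-\lambda x}\rho_\nu(xt)\,dx=\delta_{mn},\qquad m,n\ge 0,$$ and let $A_n=a_{n-1}/a_n$ for $n\ge1$. Then for every $n\ge 1$ and all such $\lambda,t$, the functions $a_n$ and $P_n(x;\cdot,\cdot)$, for each fixed real $x$, are differentiable in $\lambda$ (from the right if $\lambda=0$)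 and, if $t>0$, in $t$, and for all real $x$ $$\frac{\partial P_n}{\partial\lambda}-\frac1{a_n}\frac{\partial a_n}{\partial\lambda}\,P_n-A_nP_{n-1}=0,$$ $$\Bigl(t\frac{\partial}{\partial t}-x\frac{\partial}{\partial x}\Bigr)P_n-\Bigl[\frac{t}{a_n}\frac{\partial a_n}{\partial t}-n\Bigr]P_n+\lambda A_nP_{n-1}=0,$$ where for $t=0$ the terms containing $t\,\partial/\partial t$ are read as $0$. -/

import Mathlib

open MeasureTheory Set Polynomial

/-- The modified Bessel function of the second kind (Macdonald function)
`K_ν(z) = ∫_0^∞ e^{-z cosh u} cosh(ν u) du`, for real order `ν` and real argument `z > 0`. -/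
noncomputable def besselK (ν z : ℝ) : ℝ :=
  ∫ u in Ioi (0 : ℝ), Real.exp (-z * Real.cosh u) * Real.cosh (ν * u)

/-- The scaled Macdonald function `ρ_ν(x) = 2 x^{ν/2} K_ν(2 √x)` for `x > 0`, extended to `x = 0`
by its limit `ρ_ν(0) = Γ(ν)`, which is finite for `ν > 0`. -/
noncomputable def rho (ν x : ℝ) : ℝ :=
  if x = 0 then Real.Gamma ν else 2 * x ^ (ν / 2) * besselK ν (2 * Real.sqrt x)

/-- The weight `x^α e^{-λ x} ρ_ν(x t)` on `x > 0` (the parameter `λ` is written `l`). -/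
noncomputable def weight (α ν l t x : ℝ) : ℝ :=
  x ^ α * Real.exp (-l * x) * rho ν (x * t)

/-- The admissible parameters: `λ, t ≥ 0` with `λ² + t² ≠ 0`; if `t = 0`, then the weight contains
the factor `ρ_ν(0)`, so that `ν > 0` is needed in this case. -/
def Admissible (ν l t : ℝ) : Prop :=
  0 ≤ l ∧ 0 ≤ t ∧ l ^ 2 + t ^ 2 ≠ 0 ∧ (t = 0 → 0 < ν)

/-- `p` is the sequence of orthonormal polynomials for the weight `x^α e^{-λ x} ρ_ν(x t)` on
`(0, ∞)`: `p n` has degree `n` and positive leading coefficient, and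
`∫_0^∞ p_m p_n x^α e^{-λ x} ρ_ν(x t) dx = δ_{mn}`, all these integrals being convergent. -/
structure IsOrthonormalSeq (α ν l t : ℝ) (p : ℕ → ℝ[X]) : Prop where
  natDegree_eq : ∀ n, (p n).natDegree = n
  leadingCoeff_pos : ∀ n, 0 < (p n).leadingCoeff
  integrable : ∀ m n, IntegrableOn
    (fun x : ℝ => (p m).eval x * (p n).eval x * weight α ν l t x) (Ioi 0)
  integral_eq : ∀ m n,
    ∫ x in Ioi (0 : ℝ), (p m).eval x * (p n).eval x * weight α ν l t x = if m = n then 1 else 0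

/-!
Orthonormal polynomials depend on the weight only through its moments. The Gram–Schmidt formula,
with its norms computed by Parseval's identity, expresses `p_n` through the moments and
`p_0, …, p_{n-1}`, so by induction `p_n` is differentiable wherever the moments are.

Write `L` for integration against the weight. The derivative in `λ` of the `k`-th moment is minus
the `(k + 1)`-st moment. Differentiating `L (p_n * p_j) = 0` for `j < n` therefore gives
`L (∂p_n * p_j) = L (x * p_j * p_n)`, which vanishes for `j < n - 1` and equals `A_n` for
`j = n - 1`. Hence `∂p_n` is a combination of `p_n` and `p_{n-1}`, and comparing leading
coefficients determines the combination.

The substitution `x ↦ c x` carries the weight with parameters `(λ, t)` into a multiple of the one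
with parameters `(c λ, c t)`, so the `k`-th coefficient of `P_n` is homogeneous of degree
`(α + 1) / 2 + k` in `(λ, t)`. Homogeneity transfers differentiability from `λ` to `t`, and Euler's
relation `(λ ∂_λ + t ∂_t - x ∂_x) P_n = (α + 1) / 2 * P_n` turns the equation in `λ` into the one
in `t`. For `t = 0` it is Euler's relation in `λ` alone.
-/

open Filter Topology

section Orthonormal

variable {K : Type*} [Field K] [LinearOrder K]

/-- `p` is the sequence of orthonormal polynomials, with positive leading coefficients, for the
bilinear form `(f, g) ↦ L (f * g)`. This is orthonormality stripped of the weight, which enters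
only through the linear functional `L`. -/
structure IsOrthonormalFor (L : K[X] →ₗ[K] K) (p : ℕ → K[X]) : Prop where
  natDegree_eq : ∀ n, (p n).natDegree = n
  leadingCoeff_pos : ∀ n, 0 < (p n).leadingCoeff
  apply_mul : ∀ m n, L (p m * p n) = if m = n then 1 else 0

namespace IsOrthonormalFor

variable {L : K[X] →ₗ[K] K} {p q : ℕ → K[X]}

theorem coeff_pos (h : IsOrthonormalFor L p) (n : ℕ) : 0 < (p n).coeff n := by
  simpa only [leadingCoeff, h.natDegree_eq] using h.leadingCoeff_pos n

theorem degree_eq (h : IsOrthonormalFor L p) (n : ℕ) : (p n).degree = n := by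
  rw [degree_eq_natDegree (leadingCoeff_ne_zero.1 (h.leadingCoeff_pos n).ne'), h.natDegree_eq]

theorem eq_sum_of_degree_lt (h : IsOrthonormalFor L p) {r : K[X]} {n : ℕ} (hr : r.degree < n) :
    r = ∑ j ∈ Finset.range n, C (L (r * p j)) * p j := by
  let S : Polynomial.Sequence K := ⟨p, h.degree_eq⟩
  have hspan : r ∈ Submodule.span K (p '' Finset.range n) := by
    have hdegreeLT := S.span_degreeLT (m := n) fun i _ => (h.leadingCoeff_pos i).ne'.isUnit
    rw [Finset.coe_range]
    exact hdegreeLT ▸ mem_degreeLT.2 hr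
  obtain ⟨c, rfl⟩ := (Submodule.mem_span_image_finset_iff_exists_fun' K).1 hspan
  refine Finset.sum_congr rfl fun i hi => ?_
  have hcoord : L ((∑ j ∈ Finset.range n, c j • p j) * p i) = c i := by
    simp only [Finset.sum_mul, smul_mul_assoc, map_sum, map_smul, h.apply_mul, smul_eq_mul,
      mul_ite, mul_one, mul_zero, Finset.sum_ite_eq', hi, if_true]
  rw [hcoord, smul_eq_C_mul]

theorem apply_mul_eq_zero (h : IsOrthonormalFor L p) {r : K[X]} {n : ℕ} (hr : r.degree < n) :
    L (r * p n) = 0 := by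
  rw [h.eq_sum_of_degree_lt hr, Finset.sum_mul, map_sum]
  refine Finset.sum_eq_zero fun j hj => ?_
  rw [mul_assoc, ← smul_eq_C_mul, map_smul, h.apply_mul, if_neg (Finset.mem_range.1 hj).ne,
    smul_zero]

theorem apply_mul_of_natDegree_le (h : IsOrthonormalFor L p) {r : K[X]} {n : ℕ}
    (hr : r.natDegree ≤ n) : L (r * p n) = r.coeff n / (p n).coeff n := by
  set c := r.coeff n / (p n).coeff n with hc
  have hlt : (r - C c * p n).degree < n := by
    refine degree_lt_iff_coeff_zero _ _ |>.2 fun i hi => ?_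
    rcases hi.eq_or_lt with rfl | hi
    · rw [coeff_sub, coeff_C_mul, hc, div_mul_cancel₀ _ (h.coeff_pos n).ne', sub_self]
    · rw [coeff_sub, coeff_C_mul, coeff_eq_zero_of_natDegree_lt (hr.trans_lt hi),
        coeff_eq_zero_of_natDegree_lt ((h.natDegree_eq n).trans_lt hi), mul_zero, sub_zero]
  have hzero := h.apply_mul_eq_zero hlt
  rwa [sub_mul, map_sub, mul_assoc, ← smul_eq_C_mul, map_smul, h.apply_mul, if_pos rfl,
    smul_eq_mul, mul_one, sub_eq_zero] at hzero

theorem X_pow_eq_sum (h : IsOrthonormalFor L p) (n : ℕ) :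
    X ^ n = ∑ j ∈ Finset.range n, C (L (X ^ n * p j)) * p j + C (L (X ^ n * p n)) * p n := by
  rw [← Finset.sum_range_succ]
  exact h.eq_sum_of_degree_lt ((degree_X_pow_le n).trans_lt (mod_cast n.lt_succ_self))

theorem sq_apply_X_pow_mul (h : IsOrthonormalFor L p) (n : ℕ) :
    L (X ^ n * p n) ^ 2
      = L (X ^ (2 * n)) - ∑ j ∈ Finset.range n, L (X ^ n * p j) ^ 2 := by
  have hparseval := congrArg (fun r => L (X ^ n * r)) (h.X_pow_eq_sum n)
  simp only [mul_add, Finset.mul_sum, ← smul_eq_C_mul, mul_smul_comm, map_add, map_sum,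
    map_smul, smul_eq_mul, ← pow_two, ← pow_mul, mul_comm n 2] at hparseval
  exact eq_sub_of_add_eq' hparseval.symm

variable [IsStrictOrderedRing K]

theorem apply_X_pow_mul_pos (h : IsOrthonormalFor L p) (n : ℕ) : 0 < L (X ^ n * p n) := by
  rw [h.apply_mul_of_natDegree_le (natDegree_X_pow_le n), coeff_X_pow_self]
  exact one_div_pos.2 (h.coeff_pos n)

theorem gramSchmidt (h : IsOrthonormalFor L p) (n : ℕ) :
    p n = C (L (X ^ n * p n))⁻¹ * (X ^ n - ∑ j ∈ Finset.range n, C (L (X ^ n * p j)) * p j) := by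
  rw [sub_eq_of_eq_add' (h.X_pow_eq_sum n), ← mul_assoc, ← C_mul,
    inv_mul_cancel₀ (h.apply_X_pow_mul_pos n).ne', C_1, one_mul]

protected theorem unique (hp : IsOrthonormalFor L p) (hq : IsOrthonormalFor L q) (n : ℕ) :
    p n = q n := by
  have hpn := hp.coeff_pos n
  have hqn := hq.coeff_pos n
  have hexpand : p n = C (L (p n * q n)) * q n := by
    conv_lhs => rw [hq.eq_sum_of_degree_lt
      ((hp.degree_eq n).trans_lt (mod_cast n.lt_succ_self : (n : WithBot ℕ) < (n + 1 : ℕ)))]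
    rw [Finset.sum_range_succ, Finset.sum_eq_zero, zero_add]
    intro j hj
    rw [mul_comm (p n), hp.apply_mul_eq_zero, C_0, zero_mul]
    exact (hq.degree_eq j).trans_lt (mod_cast Finset.mem_range.1 hj)
  have hdiv : (p n).coeff n / (q n).coeff n = (q n).coeff n / (p n).coeff n := by
    rw [← hq.apply_mul_of_natDegree_le (hp.natDegree_eq n).le, mul_comm,
      hp.apply_mul_of_natDegree_le (hq.natDegree_eq n).le]
  have hcoeff : (p n).coeff n = (q n).coeff n := by
    rw [div_eq_div_iff hqn.ne' hpn.ne'] at hdiv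
    exact (mul_self_inj hpn.le hqn.le).1 hdiv
  rw [hexpand, hq.apply_mul_of_natDegree_le (hp.natDegree_eq n).le, hcoeff, div_self hqn.ne', C_1,
    one_mul]

end IsOrthonormalFor

end Orthonormal

section MomentFunctional

variable {R : Type*} [CommRing R]

/-- The linear functional on polynomials with `X ^ k ↦ m k`: integration of polynomials against a
weight with moments `m`. -/
noncomputable def momentFunctional (m : ℕ → R) : R[X] →ₗ[R] R :=
  Polynomial.lsum fun k => m k • LinearMap.id

theorem momentFunctional_eq_sum (m : ℕ → R) {p : R[X]} {N : ℕ} (hp : p.natDegree < N) :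
    momentFunctional m p = ∑ k ∈ Finset.range N, p.coeff k * m k := by
  rw [momentFunctional, Polynomial.lsum_apply,
    Polynomial.sum_over_range' _ (fun _ => map_zero _) N hp]
  simp only [LinearMap.smul_apply, LinearMap.id_apply, smul_eq_mul, mul_comm]

theorem momentFunctional_X_pow (m : ℕ → R) (k : ℕ) : momentFunctional m (X ^ k) = m k := by
  rw [momentFunctional_eq_sum m ((natDegree_X_pow_le k).trans_lt k.lt_succ_self)]
  simp [coeff_X_pow]

theorem momentFunctional_pow (x : R) (p : R[X]) :
    momentFunctional (fun k => x ^ k) p = p.eval x := by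
  rw [momentFunctional_eq_sum _ p.natDegree.lt_succ_self, eval_eq_sum_range]

theorem momentFunctional_neg_succ (m : ℕ → R) (p : R[X]) :
    momentFunctional (fun k => -m (k + 1)) p = -momentFunctional m (X * p) := by
  induction p using Polynomial.induction_on' with
  | add p q hp hq => rw [map_add, hp, hq, mul_add, map_add, neg_add]
  | monomial k c =>
    rw [← C_mul_X_pow_eq_monomial, mul_left_comm, ← pow_succ', ← smul_eq_C_mul, ← smul_eq_C_mul,
      map_smul, map_smul, momentFunctional_X_pow, momentFunctional_X_pow, smul_neg]

end MomentFunctional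

section CoeffDeriv

variable {𝕜 : Type*} [NontriviallyNormedField 𝕜] {q r : 𝕜 → 𝕜[X]} {q' r' : 𝕜[X]} {S : Set 𝕜}
  {s : 𝕜}

/-- The family of polynomials `q u` has the derivative `q'` within `S` at `u = s`, coefficient by
coefficient. The degrees are required to be bounded near `s`, so that the family lives in a
finite-dimensional space there and evaluations may be differentiated term by term. -/
structure HasCoeffDerivWithinAt (q : 𝕜 → 𝕜[X]) (q' : 𝕜[X]) (S : Set 𝕜) (s : 𝕜) : Prop where
  exists_natDegree_le : ∃ N, ∀ᶠ u in 𝓝[S] s, (q u).natDegree ≤ N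
  coeff : ∀ k, HasDerivWithinAt (fun u => (q u).coeff k) (q'.coeff k) S s

theorem hasCoeffDerivWithinAt_const (f : 𝕜[X]) (S : Set 𝕜) (s : 𝕜) :
    HasCoeffDerivWithinAt (fun _ => f) 0 S s :=
  ⟨⟨f.natDegree, .of_forall fun _ => le_rfl⟩, fun _ => hasDerivWithinAt_const _ _ _⟩

theorem hasCoeffDerivWithinAt_C {f : 𝕜 → 𝕜} {f' : 𝕜} (hf : HasDerivWithinAt f f' S s) :
    HasCoeffDerivWithinAt (fun u => C (f u)) (C f') S s := by
  refine ⟨⟨0, .of_forall fun u => (natDegree_C _).le⟩, fun k => ?_⟩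
  rcases eq_or_ne k 0 with rfl | hk
  · simpa only [coeff_C_zero] using hf
  · simpa only [coeff_C_of_ne_zero hk] using hasDerivWithinAt_const s S 0

namespace HasCoeffDerivWithinAt

theorem congr_of_eventuallyEq (h : HasCoeffDerivWithinAt q q' S s) (hr : r =ᶠ[𝓝[S] s] q)
    (hs : s ∈ S) : HasCoeffDerivWithinAt r q' S s := by
  obtain ⟨⟨N, hN⟩, hcoeff⟩ := h
  refine ⟨⟨N, ?_⟩, fun k => (hcoeff k).congr_of_eventuallyEq_of_mem ?_ hs⟩
  · filter_upwards [hr, hN] with u hu huN using hu ▸ huN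
  · filter_upwards [hr] with u hu using congrArg (fun f => f.coeff k) hu

theorem add (hq : HasCoeffDerivWithinAt q q' S s) (hr : HasCoeffDerivWithinAt r r' S s) :
    HasCoeffDerivWithinAt (fun u => q u + r u) (q' + r') S s := by
  obtain ⟨⟨N, hN⟩, hqc⟩ := hq
  obtain ⟨⟨M, hM⟩, hrc⟩ := hr
  refine ⟨⟨max N M, ?_⟩, fun k => ?_⟩
  · filter_upwards [hN, hM] with u huN huM using
      (natDegree_add_le _ _).trans (max_le_max huN huM)
  · simpa only [coeff_add] using (hqc k).fun_add (hrc k)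

theorem neg (hq : HasCoeffDerivWithinAt q q' S s) :
    HasCoeffDerivWithinAt (fun u => -q u) (-q') S s := by
  obtain ⟨hdeg, hcoeff⟩ := hq
  exact ⟨by simpa only [natDegree_neg] using hdeg,
    fun k => by simpa only [coeff_neg] using (hcoeff k).fun_neg⟩

theorem sub (hq : HasCoeffDerivWithinAt q q' S s) (hr : HasCoeffDerivWithinAt r r' S s) :
    HasCoeffDerivWithinAt (fun u => q u - r u) (q' - r') S s := by
  simpa only [sub_eq_add_neg] using hq.add hr.neg

theorem mul (hq : HasCoeffDerivWithinAt q q' S s) (hr : HasCoeffDerivWithinAt r r' S s) :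
    HasCoeffDerivWithinAt (fun u => q u * r u) (q' * r s + q s * r') S s := by
  obtain ⟨⟨N, hN⟩, hqc⟩ := hq
  obtain ⟨⟨M, hM⟩, hrc⟩ := hr
  refine ⟨⟨N + M, ?_⟩, fun k => ?_⟩
  · filter_upwards [hN, hM] with u huN huM using natDegree_mul_le.trans (add_le_add huN huM)
  · simp only [coeff_add, coeff_mul, ← Finset.sum_add_distrib]
    exact HasDerivWithinAt.fun_sum fun i _ => (hqc i.1).mul (hrc i.2)

theorem sum {ι : Type*} {I : Finset ι} {f : ι → 𝕜 → 𝕜[X]} {f' : ι → 𝕜[X]}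
    (hf : ∀ i ∈ I, HasCoeffDerivWithinAt (f i) (f' i) S s) :
    HasCoeffDerivWithinAt (fun u => ∑ i ∈ I, f i u) (∑ i ∈ I, f' i) S s := by
  classical
  induction I using Finset.induction_on with
  | empty => exact hasCoeffDerivWithinAt_const 0 S s
  | insert i I hi ih =>
    simp only [Finset.sum_insert hi]
    exact (hf i (I.mem_insert_self i)).add (ih fun j hj => hf j (Finset.mem_insert_of_mem hj))

theorem hasDerivWithinAt_momentFunctional {m : 𝕜 → ℕ → 𝕜} {m' : ℕ → 𝕜}
    (hq : HasCoeffDerivWithinAt q q' S s)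
    (hm : ∀ k, HasDerivWithinAt (fun u => m u k) (m' k) S s) (hs : s ∈ S) :
    HasDerivWithinAt (fun u => momentFunctional (m u) (q u))
      (momentFunctional (m s) q' + momentFunctional m' (q s)) S s := by
  obtain ⟨⟨N, hN⟩, hcoeff⟩ := hq
  set M := max N q'.natDegree
  have hM : ∀ᶠ u in 𝓝[S] s, (q u).natDegree < M + 1 := by
    filter_upwards [hN] with u hu using Nat.lt_succ_of_le (hu.trans (le_max_left _ _))
  rw [momentFunctional_eq_sum _ (Nat.lt_succ_of_le (le_max_right N q'.natDegree)),
    momentFunctional_eq_sum _ (hM.self_of_nhdsWithin hs), ← Finset.sum_add_distrib]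
  refine HasDerivWithinAt.congr_of_eventuallyEq_of_mem
    (HasDerivWithinAt.fun_sum fun k _ => (hcoeff k).mul (hm k)) ?_ hs
  filter_upwards [hM] with u hu using momentFunctional_eq_sum _ hu

theorem hasDerivWithinAt_eval (hq : HasCoeffDerivWithinAt q q' S s) (hs : s ∈ S) (x : 𝕜) :
    HasDerivWithinAt (fun u => (q u).eval x) (q'.eval x) S s := by
  have h := hq.hasDerivWithinAt_momentFunctional (m := fun _ k => x ^ k)
    (fun k => hasDerivWithinAt_const s S _) hs
  have hzero : momentFunctional (fun _ : ℕ => (0 : 𝕜)) (q s) = 0 := by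
    rw [momentFunctional_eq_sum _ (Nat.lt_succ_self _)]
    simp only [mul_zero, Finset.sum_const_zero]
  simpa only [momentFunctional_pow, hzero, add_zero] using h

theorem hasDerivWithinAt_leadingCoeff {n : ℕ} (hq : HasCoeffDerivWithinAt q q' S s) (hs : s ∈ S)
    (hn : ∀ᶠ u in 𝓝[S] s, (q u).natDegree = n) :
    HasDerivWithinAt (fun u => (q u).leadingCoeff) (q'.coeff n) S s := by
  refine (hq.coeff n).congr_of_eventuallyEq_of_mem ?_ hs
  filter_upwards [hn] with u hu
  rw [leadingCoeff, hu]

theorem natDegree_le {n : ℕ} (hq : HasCoeffDerivWithinAt q q' S s)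
    (hS : UniqueDiffWithinAt 𝕜 S s) (hs : s ∈ S) (hn : ∀ᶠ u in 𝓝[S] s, (q u).natDegree ≤ n) :
    q'.natDegree ≤ n := by
  refine natDegree_le_iff_coeff_eq_zero.2 fun k hk => hS.eq_deriv _ (hq.coeff k) ?_
  refine (hasDerivWithinAt_const s S 0).congr_of_eventuallyEq_of_mem ?_ hs
  filter_upwards [hn] with u hu using coeff_eq_zero_of_natDegree_lt (hu.trans_lt hk)

end HasCoeffDerivWithinAt

end CoeffDeriv

section MomentFamily

variable {m : ℝ → ℕ → ℝ} {p : ℝ → ℕ → ℝ[X]} {S : Set ℝ} {s : ℝ}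

-- The Gram–Schmidt formula and Parseval's identity for `X ^ n` express `p u n` through the moments
-- and the `p u j` with `j < n`.
theorem exists_hasCoeffDerivWithinAt_of_isOrthonormalFor {m' : ℕ → ℝ}
    (hp : ∀ᶠ u in 𝓝[S] s, IsOrthonormalFor (momentFunctional (m u)) (p u)) (hs : s ∈ S)
    (hm : ∀ k, HasDerivWithinAt (fun u => m u k) (m' k) S s) (n : ℕ) :
    ∃ q', HasCoeffDerivWithinAt (fun u => p u n) q' S s := by
  induction n using Nat.strong_induction_on with
  | _ n ih =>
    choose! d hd using ih
    have hproj : ∀ j < n, DifferentiableWithinAt ℝ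
        (fun u => momentFunctional (m u) (X ^ n * p u j)) S s := fun j hj =>
      (((hasCoeffDerivWithinAt_const (X ^ n) S s).mul
        (hd j hj)).hasDerivWithinAt_momentFunctional hm hs).differentiableWithinAt
    have hps := hp.self_of_nhdsWithin hs
    have hnorm_sq : DifferentiableWithinAt ℝ
        (fun u => momentFunctional (m u) (X ^ n * p u n) ^ 2) S s := by
      refine DifferentiableWithinAt.congr_of_eventuallyEq_of_mem
        ((hm (2 * n)).differentiableWithinAt.fun_sub (.fun_sum (u := Finset.range n)
          fun j hj => (hproj j (Finset.mem_range.1 hj)).fun_pow 2)) ?_ hs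
      filter_upwards [hp] with u hu
      rw [hu.sq_apply_X_pow_mul, momentFunctional_X_pow]
    have hnorm : DifferentiableWithinAt ℝ
        (fun u => momentFunctional (m u) (X ^ n * p u n)) S s := by
      refine (hnorm_sq.sqrt (pow_pos (hps.apply_X_pow_mul_pos n) 2).ne'
        ).congr_of_eventuallyEq_of_mem ?_ hs
      filter_upwards [hp] with u hu using (Real.sqrt_sq (hu.apply_X_pow_mul_pos n).le).symm
    have hinv := (hnorm.fun_inv (hps.apply_X_pow_mul_pos n).ne').hasDerivWithinAt
    have hsum := HasCoeffDerivWithinAt.sum (I := Finset.range n) fun j hj =>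
      (hasCoeffDerivWithinAt_C (hproj j (Finset.mem_range.1 hj)).hasDerivWithinAt).mul
        (hd j (Finset.mem_range.1 hj))
    refine ⟨_, ((hasCoeffDerivWithinAt_C hinv).mul
      ((hasCoeffDerivWithinAt_const (X ^ n) S s).sub hsum)).congr_of_eventuallyEq ?_ hs⟩
    filter_upwards [hp] with u hu using hu.gramSchmidt n

theorem momentFunctional_coeffDeriv_mul {n j : ℕ} {q' : ℝ[X]}
    (hp : ∀ᶠ u in 𝓝[S] s, IsOrthonormalFor (momentFunctional (m u)) (p u)) (hs : s ∈ S)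
    (hS : UniqueDiffWithinAt ℝ S s)
    (hm : ∀ k, HasDerivWithinAt (fun u => m u k) (-m s (k + 1)) S s)
    (hq : HasCoeffDerivWithinAt (fun u => p u n) q' S s) (hj : j < n) :
    momentFunctional (m s) (q' * p s j) = momentFunctional (m s) (X * p s j * p s n) := by
  have hps := hp.self_of_nhdsWithin hs
  obtain ⟨r', hr⟩ := exists_hasCoeffDerivWithinAt_of_isOrthonormalFor hp hs hm j
  have hdeg : r'.degree < n := by
    refine degree_le_natDegree.trans_lt (mod_cast (hr.natDegree_le hS hs ?_).trans_lt hj)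
    filter_upwards [hp] with u hu using (hu.natDegree_eq j).le
  have hconst : HasDerivWithinAt (fun u => momentFunctional (m u) (p u n * p u j)) 0 S s := by
    refine (hasDerivWithinAt_const s S 0).congr_of_eventuallyEq_of_mem ?_ hs
    filter_upwards [hp] with u hu
    rw [hu.apply_mul, if_neg hj.ne']
  have hsum := hS.eq_deriv _ ((hq.mul hr).hasDerivWithinAt_momentFunctional hm hs) hconst
  rw [map_add, mul_comm (p s n) r', hps.apply_mul_eq_zero hdeg, momentFunctional_neg_succ,
    add_zero, ← sub_eq_add_neg, sub_eq_zero] at hsum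
  rw [hsum, mul_comm (p s n), mul_assoc]

theorem coeffDeriv_eq_C_mul_add_C_mul {n : ℕ} {q' : ℝ[X]}
    (hp : ∀ᶠ u in 𝓝[S] s, IsOrthonormalFor (momentFunctional (m u)) (p u)) (hs : s ∈ S)
    (hS : UniqueDiffWithinAt ℝ S s)
    (hm : ∀ k, HasDerivWithinAt (fun u => m u k) (-m s (k + 1)) S s)
    (hq : HasCoeffDerivWithinAt (fun u => p u (n + 1)) q' S s) :
    q' = C (q'.coeff (n + 1) / (p s (n + 1)).coeff (n + 1)) * p s (n + 1)
      + C ((p s n).coeff n / (p s (n + 1)).coeff (n + 1)) * p s n := by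
  have hps := hp.self_of_nhdsWithin hs
  have hdeg : q'.natDegree ≤ n + 1 := by
    refine hq.natDegree_le hS hs ?_
    filter_upwards [hp] with u hu using (hu.natDegree_eq (n + 1)).le
  have hproj : ∀ j ≤ n, momentFunctional (m s) (q' * p s j)
      = (p s j).coeff n / (p s (n + 1)).coeff (n + 1) := fun j hj => by
    rw [momentFunctional_coeffDeriv_mul hp hs hS hm hq (Nat.lt_succ_of_le hj),
      hps.apply_mul_of_natDegree_le, coeff_X_mul]
    rw [natDegree_X_mul (leadingCoeff_ne_zero.1 (hps.leadingCoeff_pos j).ne'), hps.natDegree_eq]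
    exact Nat.succ_le_succ hj
  have hlow : ∀ j ∈ Finset.range n, C (momentFunctional (m s) (q' * p s j)) * p s j = 0 := by
    intro j hj
    have hjn := Finset.mem_range.1 hj
    rw [hproj j hjn.le, coeff_eq_zero_of_natDegree_lt ((hps.natDegree_eq j).trans_lt hjn), zero_div,
      C_0, zero_mul]
  conv_lhs => rw [hps.eq_sum_of_degree_lt (r := q') (n := n + 2)
    (degree_le_natDegree.trans_lt (mod_cast Nat.lt_succ_of_le hdeg)), Finset.sum_range_succ,
    Finset.sum_range_succ, Finset.sum_eq_zero hlow, hproj n le_rfl,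
    hps.apply_mul_of_natDegree_le hdeg, zero_add, add_comm]

end MomentFamily

section Laplace

theorem abs_exp_neg_mul_sub_exp_neg_mul_le {x s₀ s u : ℝ} (hx : 0 ≤ x) (hs : s₀ ≤ s)
    (hu : s₀ ≤ u) :
    |Real.exp (-u * x) - Real.exp (-s * x)| ≤ x * Real.exp (-s₀ * x) * |u - s| := by
  have hderiv : ∀ r ∈ Ici s₀,
      HasDerivWithinAt (fun r => Real.exp (-r * x)) (Real.exp (-r * x) * (-1 * x)) (Ici s₀) r :=
    fun r _ => (((hasDerivAt_id r).fun_neg.mul_const x).exp).hasDerivWithinAt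
  have hbound : ∀ r ∈ Ici s₀, ‖Real.exp (-r * x) * (-1 * x)‖ ≤ x * Real.exp (-s₀ * x) := by
    intro r hr
    rw [neg_one_mul, norm_mul, norm_neg, Real.norm_of_nonneg (Real.exp_pos _).le,
      Real.norm_of_nonneg hx, mul_comm]
    have hr' : s₀ ≤ r := hr
    gcongr
  exact (convex_Ici s₀).norm_image_sub_le_of_norm_hasDerivWithin_le hderiv hbound hs hu

theorem integrable_exp_neg_mul_mul_of_le {μ : Measure ℝ} (hμ : ∀ᵐ x ∂μ, 0 ≤ x) {v : ℝ → ℝ}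
    {s₀ u : ℝ} (hu : s₀ ≤ u) (hv : Integrable (fun x => Real.exp (-s₀ * x) * v x) μ) :
    Integrable (fun x => Real.exp (-u * x) * v x) μ := by
  have hsplit : (fun x => Real.exp (-u * x) * v x)
      = fun x => Real.exp (-(u - s₀) * x) * (Real.exp (-s₀ * x) * v x) := by
    funext x
    rw [← mul_assoc, ← Real.exp_add]
    ring_nf
  rw [hsplit]
  refine hv.bdd_mul (c := 1) (by fun_prop) ?_
  filter_upwards [hμ] with x hx
  rw [Real.norm_of_nonneg (Real.exp_pos _).le, Real.exp_le_one_iff]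
  nlinarith

theorem hasDerivWithinAt_integral_exp_neg_mul_mul {μ : Measure ℝ} (hμ : ∀ᵐ x ∂μ, 0 ≤ x)
    {v : ℝ → ℝ} {s₀ s : ℝ} (hs : s₀ ≤ s)
    (hv : Integrable (fun x => Real.exp (-s₀ * x) * v x) μ)
    (hxv : Integrable (fun x => x * (Real.exp (-s₀ * x) * v x)) μ) :
    HasDerivWithinAt (fun u => ∫ x, Real.exp (-u * x) * v x ∂μ)
      (-∫ x, x * (Real.exp (-s * x) * v x) ∂μ) (Ici s₀) s := by
  have hint : ∀ u ∈ Ici s₀, Integrable (fun x => Real.exp (-u * x) * v x) μ := fun u hu =>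
    integrable_exp_neg_mul_mul_of_le hμ hu hv
  have hpt : ∀ x : ℝ, HasDerivAt (fun u => Real.exp (-u * x) * v x)
      (-(x * (Real.exp (-s * x) * v x))) s := fun x =>
    ((((hasDerivAt_id' s).fun_neg.mul_const x).exp).mul_const (v x)).congr_deriv (by ring)
  have hslope : Tendsto (fun u => ∫ x, slope (fun u => Real.exp (-u * x) * v x) s u ∂μ)
      (𝓝[Ici s₀ \ {s}] s) (𝓝 (∫ x, -(x * (Real.exp (-s * x) * v x)) ∂μ)) := by
    refine tendsto_integral_filter_of_dominated_convergence
      (fun x => ‖x * (Real.exp (-s₀ * x) * v x)‖) ?_ ?_ hxv.norm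
      (ae_of_all _ fun x => hasDerivWithinAt_iff_tendsto_slope.1 (hpt x).hasDerivWithinAt)
    · filter_upwards [self_mem_nhdsWithin] with u hu
      simp only [slope_def_field]
      exact (((hint u hu.1).sub (hint s hs)).div_const _).aestronglyMeasurable
    · filter_upwards [self_mem_nhdsWithin] with u hu
      filter_upwards [hμ] with x hx
      rw [slope_def_field, ← sub_mul, norm_div, div_le_iff₀ (norm_pos_iff.2 (sub_ne_zero.2 hu.2))]
      calc ‖(Real.exp (-u * x) - Real.exp (-s * x)) * v x‖
          ≤ x * Real.exp (-s₀ * x) * |u - s| * ‖v x‖ := by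
            rw [norm_mul]
            gcongr
            exact abs_exp_neg_mul_sub_exp_neg_mul_le hx hs hu.1
        _ = ‖x * (Real.exp (-s₀ * x) * v x)‖ * ‖u - s‖ := by
            rw [norm_mul, norm_mul, Real.norm_of_nonneg hx,
              Real.norm_of_nonneg (Real.exp_pos _).le, Real.norm_eq_abs (u - s)]
            ring
  rw [hasDerivWithinAt_iff_tendsto_slope, ← integral_neg]
  refine hslope.congr' ?_
  filter_upwards [self_mem_nhdsWithin] with u hu
  simp only [slope_def_field]
  rw [integral_div, integral_sub (hint u hu.1) (hint s hs)]

end Laplace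

section Euler

theorem mul_deriv_eq_of_homogeneous {g : ℝ → ℝ} {β g' l : ℝ} (hl : 0 ≤ l)
    (hhom : ∀ c, 0 < c → g (c * l) = c ^ β * g l) (hg : HasDerivWithinAt g g' (Ici 0) l) :
    l * g' = β * g l := by
  have hchain : HasDerivAt (fun c => g (c * l)) (g' * (1 * l)) 1 :=
    hg.comp_hasDerivAt_of_eq 1 ((hasDerivAt_id (1 : ℝ)).mul_const l)
      (by filter_upwards [Ioi_mem_nhds one_pos] with c hc using mul_nonneg (le_of_lt hc) hl)
      (one_mul l).symm
  have hpow : HasDerivAt (fun c => g (c * l)) (β * 1 ^ (β - 1) * g l) 1 := by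
    refine ((Real.hasDerivAt_rpow_const (Or.inl one_ne_zero)).mul_const (g l)
      ).congr_of_eventuallyEq ?_
    filter_upwards [Ioi_mem_nhds one_pos] with c hc using hhom c hc
  have huniq := hchain.unique hpow
  rwa [Real.one_rpow, mul_one, one_mul, mul_comm] at huniq

-- Homogeneity turns the second variable into the first: `f l s = (s / t) ^ β * f (t / s * l) t`.
theorem hasDerivAt_right_of_homogeneous {f : ℝ → ℝ → ℝ} {β f' l t : ℝ} (hl : 0 ≤ l) (ht : 0 < t)
    (hhom : ∀ᶠ s in 𝓝 t, ∀ c, 0 < c → f (c * l) (c * s) = c ^ β * f l s)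
    (hf : HasDerivWithinAt (fun s => f s t) f' (Ici 0) l) :
    HasDerivAt (fun s => f l s) (t⁻¹ * (β * f l t - l * f')) t := by
  have hquot : HasDerivAt (fun s => t / s * l) (-(l / t)) t := by
    refine (((hasDerivAt_inv ht.ne').const_mul t).mul_const l).congr_deriv ?_
    field_simp
  have hleft : HasDerivAt (fun s => f (t / s * l) t) (f' * -(l / t)) t :=
    hf.comp_hasDerivAt_of_eq t hquot
      (by filter_upwards [Ioi_mem_nhds ht] with s hs using
            mul_nonneg (div_nonneg ht.le (le_of_lt hs)) hl)
      (by rw [div_self ht.ne', one_mul])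
  have hpow : HasDerivAt (fun s : ℝ => (s / t) ^ β) (1 / t * β * (t / t) ^ (β - 1)) t :=
    ((hasDerivAt_id t).div_const t).rpow_const (Or.inl (div_ne_zero ht.ne' ht.ne'))
  refine ((hpow.mul hleft).congr_of_eventuallyEq ?_).congr_deriv ?_
  · filter_upwards [hhom, Ioi_mem_nhds ht] with s hs hs0
    have hs0 : 0 < s := hs0
    have hsc := hs (t / s) (div_pos ht hs0)
    rw [div_mul_cancel₀ t hs0.ne'] at hsc
    simp only [Pi.mul_apply]
    rw [hsc, ← mul_assoc, ← Real.mul_rpow (div_pos hs0 ht).le (div_pos ht hs0).le,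
      div_mul_div_cancel₀ ht.ne', div_self hs0.ne', Real.one_rpow, one_mul]
  · rw [div_self ht.ne', Real.one_rpow, Real.one_rpow, one_mul]
    ring

theorem mul_derivWithin_Ici_eq_mul {f : ℝ → ℝ} {f' t : ℝ} (ht : 0 ≤ t)
    (hf : 0 < t → HasDerivAt f f' t) : t * derivWithin f (Ici 0) t = t * f' := by
  rcases ht.eq_or_lt with rfl | ht'
  · rw [zero_mul, zero_mul]
  · rw [(hf ht').hasDerivWithinAt.derivWithin (uniqueDiffOn_Ici 0 t ht)]

theorem coeff_X_mul_derivative {R : Type*} [CommRing R] (f : R[X]) (k : ℕ) :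
    (X * derivative f).coeff k = k * f.coeff k := by
  rcases k with _ | k
  · rw [coeff_X_mul_zero, Nat.cast_zero, zero_mul]
  · rw [coeff_X_mul, coeff_derivative, Nat.cast_succ, mul_comm]

theorem C_mul_eq_of_euler {K : Type*} [Field K] {γ t l : K} {f d e r : K[X]} {n : ℕ}
    (hf : f.natDegree = n) (hf0 : f ≠ 0) (hd : d = C (d.coeff n / f.leadingCoeff) * f + r)
    (he : C t * e = C γ * f + X * derivative f - C l * d) :
    C t * e = X * derivative f + C (t / f.leadingCoeff * e.coeff n - n) * f - C l * r := by
  have hlead : f.leadingCoeff ≠ 0 := leadingCoeff_ne_zero.2 hf0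
  have hcoeff := congrArg (fun g => g.coeff n) he
  simp only [coeff_C_mul, coeff_sub, coeff_add, coeff_X_mul_derivative] at hcoeff
  have hscalar : t / f.leadingCoeff * e.coeff n - n = γ - l * (d.coeff n / f.leadingCoeff) := by
    rw [← hf, coeff_natDegree, hf] at hcoeff
    field_simp
    linear_combination hcoeff
  rw [hscalar, C_sub, C_mul]
  linear_combination he - C l * hd

end Euler

section Weight

variable {μ : Measure ℝ} {w w' : ℝ → ℝ} {p q : ℕ → ℝ[X]}

/-- `p` is the sequence of orthonormal polynomials, with positive leading coefficients, for the
(possibly signed) weight `w` with respect to `μ`. Integrability is part of the notion, since the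
Bochner integral of a non-integrable function is `0`. -/
structure IsOrthonormalWeight (μ : Measure ℝ) (w : ℝ → ℝ) (p : ℕ → ℝ[X]) : Prop where
  natDegree_eq : ∀ n, (p n).natDegree = n
  leadingCoeff_pos : ∀ n, 0 < (p n).leadingCoeff
  integrable : ∀ m n, Integrable (fun x => (p m).eval x * (p n).eval x * w x) μ
  integral_eq : ∀ m n, ∫ x, (p m).eval x * (p n).eval x * w x ∂μ = if m = n then 1 else 0

/-- The moments `∫ x ^ k * w x ∂μ` of the weight `w`. -/
noncomputable def moment (μ : Measure ℝ) (w : ℝ → ℝ) (k : ℕ) : ℝ :=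
  ∫ x, x ^ k * w x ∂μ

theorem momentFunctional_moment (hw : ∀ k, Integrable (fun x => x ^ k * w x) μ) (f : ℝ[X]) :
    momentFunctional (moment μ w) f = ∫ x, f.eval x * w x ∂μ := by
  simp only [momentFunctional_eq_sum _ f.natDegree.lt_succ_self, moment, eval_eq_sum_range,
    Finset.sum_mul, mul_assoc, ← integral_const_mul]
  exact (integral_finsetSum _ fun k _ => (hw k).const_mul (f.coeff k)).symm

namespace IsOrthonormalWeight

theorem integrable_eval_mul (h : IsOrthonormalWeight μ w p) (f : ℝ[X]) :
    Integrable (fun x => f.eval x * w x) μ := by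
  let S : Polynomial.Sequence ℝ := ⟨p, fun n => by
    rw [degree_eq_natDegree (leadingCoeff_ne_zero.1 (h.leadingCoeff_pos n).ne'), h.natDegree_eq]⟩
  have hspan : f ∈ Submodule.span ℝ (range S) :=
    (S.span fun n => (h.leadingCoeff_pos n).ne'.isUnit).symm ▸ Submodule.mem_top
  induction hspan using Submodule.span_induction with
  | mem f hf =>
    obtain ⟨n, rfl⟩ := hf
    obtain ⟨c, hc⟩ := natDegree_eq_zero.1 (h.natDegree_eq 0)
    have hc0 : c ≠ 0 := by simpa only [← hc, leadingCoeff_C] using (h.leadingCoeff_pos 0).ne'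
    convert (h.integrable 0 n).const_mul c⁻¹ using 2 with x
    rw [← hc, eval_C, mul_assoc, inv_mul_cancel_left₀ hc0]
  | zero =>
    simp only [eval_zero, zero_mul]
    exact integrable_zero ℝ ℝ μ
  | add f g _ _ hf hg => simpa only [eval_add, add_mul] using hf.fun_add hg
  | smul c f _ hf => simpa only [eval_smul, smul_eq_mul, mul_assoc] using hf.const_mul c

theorem integrable_pow_mul (h : IsOrthonormalWeight μ w p) (k : ℕ) :
    Integrable (fun x => x ^ k * w x) μ := by
  simpa only [eval_pow, eval_X] using h.integrable_eval_mul (X ^ k)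

theorem isOrthonormalFor (h : IsOrthonormalWeight μ w p) :
    IsOrthonormalFor (momentFunctional (moment μ w)) p where
  natDegree_eq := h.natDegree_eq
  leadingCoeff_pos := h.leadingCoeff_pos
  apply_mul m n := by
    rw [momentFunctional_moment h.integrable_pow_mul, ← h.integral_eq m n]
    simp only [eval_mul]

theorem congr (h : IsOrthonormalWeight μ w p) (hw : w =ᵐ[μ] w') : IsOrthonormalWeight μ w' p := by
  have hmul : ∀ m n, (fun x => (p m).eval x * (p n).eval x * w x)
      =ᵐ[μ] fun x => (p m).eval x * (p n).eval x * w' x := fun m n => by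
    filter_upwards [hw] with x hx using congrArg _ hx
  exact ⟨h.natDegree_eq, h.leadingCoeff_pos, fun m n => (h.integrable m n).congr (hmul m n),
    fun m n => (integral_congr_ae (hmul m n)).symm.trans (h.integral_eq m n)⟩

theorem comp_mul_left (h : IsOrthonormalWeight (volume.restrict (Ioi 0)) w p) {b c : ℝ}
    (hb : 0 < b) (hc : 0 < c) :
    IsOrthonormalWeight (volume.restrict (Ioi 0)) (fun x => c / b ^ 2 * w (c * x))
      (fun n => C b * (p n).comp (C c * X)) := by
  have hdeg : ∀ n, (C b * (p n).comp (C c * X)).natDegree = n := fun n => by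
    rw [natDegree_C_mul hb.ne', natDegree_comp, natDegree_C_mul_X _ hc.ne', h.natDegree_eq, mul_one]
  let f : ℕ → ℕ → ℝ → ℝ := fun m n y => (p m).eval y * (p n).eval y * w y
  have hsubst : ∀ m n, (fun x => (C b * (p m).comp (C c * X)).eval x
        * (C b * (p n).comp (C c * X)).eval x * (c / b ^ 2 * w (c * x)))
      = fun x => c * f m n (c * x) := fun m n => by
    funext x
    simp only [f, eval_mul, eval_C, eval_comp, eval_X]
    field_simp
  refine ⟨hdeg, fun n => ?_, fun m n => ?_, fun m n => ?_⟩
  · rw [leadingCoeff, hdeg, coeff_C_mul, comp_C_mul_X_coeff]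
    exact mul_pos hb (mul_pos (h.isOrthonormalFor.coeff_pos n) (pow_pos hc n))
  · rw [hsubst]
    refine Integrable.const_mul ((integrableOn_Ioi_comp_mul_left_iff (f m n) 0 hc).2 ?_) c
    rw [mul_zero]
    exact h.integrable m n
  · rw [hsubst, integral_const_mul, integral_comp_mul_left_Ioi (f m n) _ hc, mul_zero,
      smul_eq_mul, mul_inv_cancel_left₀ hc.ne', h.integral_eq]

end IsOrthonormalWeight

/-- The weight `x^α e^{-λ x} φ(x t)`, with an arbitrary function `φ` in the place of `ρ_ν`; the
parameter `λ` is written `l`. -/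
noncomputable def laplaceWeight (α : ℝ) (φ : ℝ → ℝ) (l t x : ℝ) : ℝ :=
  x ^ α * Real.exp (-l * x) * φ (x * t)

theorem laplaceWeight_mul_right {α c l t x : ℝ} {φ : ℝ → ℝ} (hc : 0 < c) (hx : 0 ≤ x) :
    laplaceWeight α φ l t (c * x) = c ^ α * laplaceWeight α φ (c * l) (c * t) x := by
  have hexp : -l * (c * x) = -(c * l) * x := by ring
  have harg : c * x * t = x * (c * t) := by ring
  rw [laplaceWeight, laplaceWeight, Real.mul_rpow hc.le hx, hexp, harg]
  ring

variable {α l t : ℝ} {φ : ℝ → ℝ}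

theorem IsOrthonormalWeight.rescale {c : ℝ}
    (h : IsOrthonormalWeight (volume.restrict (Ioi 0)) (laplaceWeight α φ l t) p) (hc : 0 < c) :
    IsOrthonormalWeight (volume.restrict (Ioi 0)) (laplaceWeight α φ (c * l) (c * t))
      (fun n => C (c ^ ((α + 1) / 2)) * (p n).comp (C c * X)) := by
  have hnorm : (c ^ ((α + 1) / 2)) ^ 2 = c * c ^ α := by
    rw [← Real.rpow_mul_natCast hc.le, Nat.cast_ofNat, div_mul_cancel₀ _ two_ne_zero, add_comm,
      Real.rpow_add hc, Real.rpow_one]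
  refine (h.comp_mul_left (Real.rpow_pos_of_pos hc ((α + 1) / 2)) hc).congr ?_
  filter_upwards [ae_restrict_mem measurableSet_Ioi] with x hx
  rw [laplaceWeight_mul_right hc (le_of_lt hx), hnorm, ← mul_assoc,
    div_mul_eq_mul_div, div_self (mul_pos hc (Real.rpow_pos_of_pos hc α)).ne', one_mul]

theorem IsOrthonormalWeight.coeff_eq_rpow_mul {c : ℝ}
    (h : IsOrthonormalWeight (volume.restrict (Ioi 0)) (laplaceWeight α φ l t) p)
    (h' : IsOrthonormalWeight (volume.restrict (Ioi 0)) (laplaceWeight α φ (c * l) (c * t)) q)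
    (hc : 0 < c) (n k : ℕ) :
    (q n).coeff k = c ^ ((α + 1) / 2 + k) * (p n).coeff k := by
  rw [h'.isOrthonormalFor.unique (h.rescale hc).isOrthonormalFor, coeff_C_mul, comp_C_mul_X_coeff,
    Real.rpow_add_natCast hc.ne']
  ring

theorem hasDerivWithinAt_moment_laplaceWeight {μ : Measure ℝ} (hμ : ∀ᵐ x ∂μ, 0 ≤ x) {s₀ : ℝ}
    (hs₀ : s₀ ≤ l) (hint : ∀ k : ℕ, Integrable (fun x => x ^ k * laplaceWeight α φ s₀ t x) μ)
    (k : ℕ) :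
    HasDerivWithinAt (fun s => moment μ (laplaceWeight α φ s t) k)
      (-moment μ (laplaceWeight α φ l t) (k + 1)) (Ici s₀) l := by
  have hmul : ∀ s x, x ^ k * laplaceWeight α φ s t x
      = Real.exp (-s * x) * (x ^ k * (x ^ α * φ (x * t))) := fun s x => by
    rw [laplaceWeight]
    ring
  have hmul_succ : ∀ s x, x ^ (k + 1) * laplaceWeight α φ s t x
      = x * (Real.exp (-s * x) * (x ^ k * (x ^ α * φ (x * t)))) := fun s x => by
    rw [pow_succ', mul_assoc, hmul]
  simp only [moment, hmul, hmul_succ]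
  exact hasDerivWithinAt_integral_exp_neg_mul_mul hμ hs₀
    (by simpa only [hmul] using hint k) (by simpa only [hmul_succ] using hint (k + 1))

end Weight

/-- `D` is a cone in the closed quadrant `{(l, t) | 0 ≤ l ∧ 0 ≤ t}`, and open relative to it: the
shape of the set of parameters for which the weights of a homogeneous family are considered. -/
structure IsRelOpenCone (D : Set (ℝ × ℝ)) : Prop where
  subset_Ici : D ⊆ Ici 0
  mem_nhdsWithin : ∀ z ∈ D, D ∈ 𝓝[Ici 0] z
  smul_mem : ∀ c : ℝ, 0 < c → ∀ z ∈ D, c • z ∈ D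

namespace IsRelOpenCone

variable {D : Set (ℝ × ℝ)} {l t : ℝ}

theorem nonneg_left (hD : IsRelOpenCone D) (h : (l, t) ∈ D) : 0 ≤ l :=
  (hD.subset_Ici h).1

theorem nonneg_right (hD : IsRelOpenCone D) (h : (l, t) ∈ D) : 0 ≤ t :=
  (hD.subset_Ici h).2

theorem eventually_left (hD : IsRelOpenCone D) (h : (l, t) ∈ D) :
    ∀ᶠ s in 𝓝[Ici 0] l, (s, t) ∈ D := by
  have hcont : Tendsto (fun s => (s, t)) (𝓝[Ici 0] l) (𝓝[Ici 0] (l, t)) :=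
    (Continuous.prodMk_left t).continuousWithinAt.tendsto_nhdsWithin fun s hs =>
      ⟨hs, hD.nonneg_right h⟩
  exact hcont (hD.mem_nhdsWithin _ h)

theorem eventually_right (hD : IsRelOpenCone D) (h : (l, t) ∈ D) (ht : 0 < t) :
    ∀ᶠ s in 𝓝 t, (l, s) ∈ D := by
  have hcont : Tendsto (fun s => (l, s)) (𝓝[Ici 0] t) (𝓝[Ici 0] (l, t)) :=
    (Continuous.prodMk_right l).continuousWithinAt.tendsto_nhdsWithin fun s hs =>
      ⟨hD.nonneg_left h, hs⟩
  rw [← nhdsWithin_eq_nhds.2 (Ici_mem_nhds ht)]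
  exact hcont (hD.mem_nhdsWithin _ h)

theorem exists_le_mem (hD : IsRelOpenCone D) (h : (l, t) ∈ D) :
    ∃ s₀ ≤ l, (s₀, t) ∈ D ∧ Ici s₀ ∈ 𝓝[Ici 0] l := by
  rcases (hD.nonneg_left h).eq_or_lt with rfl | hl
  · exact ⟨0, le_rfl, h, self_mem_nhdsWithin⟩
  · have hmem : ∀ᶠ s in 𝓝 l, (s, t) ∈ D := by
      simpa only [nhdsWithin_eq_nhds.2 (Ici_mem_nhds hl)] using hD.eventually_left h
    obtain ⟨s₀, hs₀, hs₀l⟩ :=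
      ((hmem.filter_mono nhdsWithin_le_nhds).and (self_mem_nhdsWithin (s := Iio l))).exists
    exact ⟨s₀, le_of_lt hs₀l, hs₀, mem_nhdsWithin_of_mem_nhds (Ici_mem_nhds hs₀l)⟩

end IsRelOpenCone

section Family

variable {α l t : ℝ} {φ : ℝ → ℝ} {D : Set (ℝ × ℝ)} {P : ℕ → ℝ → ℝ → ℝ[X]}

theorem exists_hasCoeffDerivWithinAt_left (hD : IsRelOpenCone D)
    (hP : ∀ l t, (l, t) ∈ D → IsOrthonormalWeight (volume.restrict (Ioi 0))
      (laplaceWeight α φ l t) (fun n => P n l t))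
    (h : (l, t) ∈ D) (n : ℕ) :
    ∃ d, HasCoeffDerivWithinAt (fun s => P (n + 1) s t) d (Ici 0) l ∧
      d = C (d.coeff (n + 1) / (P (n + 1) l t).leadingCoeff) * P (n + 1) l t
        + C ((P n l t).leadingCoeff / (P (n + 1) l t).leadingCoeff) * P n l t := by
  have hl : l ∈ Ici 0 := hD.nonneg_left h
  have horth : ∀ᶠ s in 𝓝[Ici 0] l, IsOrthonormalFor
      (momentFunctional (moment (volume.restrict (Ioi 0)) (laplaceWeight α φ s t)))
      (fun n => P n s t) := by
    filter_upwards [hD.eventually_left h] with s hs using (hP s t hs).isOrthonormalFor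
  obtain ⟨s₀, hs₀l, hs₀, hnhds⟩ := hD.exists_le_mem h
  have hμ : ∀ᵐ x ∂(volume.restrict (Ioi (0 : ℝ))), 0 ≤ x := by
    filter_upwards [ae_restrict_mem measurableSet_Ioi] with x hx using le_of_lt hx
  have hmoment := fun k => (hasDerivWithinAt_moment_laplaceWeight hμ hs₀l
    (hP s₀ t hs₀).integrable_pow_mul k).mono_of_mem_nhdsWithin hnhds
  obtain ⟨d, hd⟩ := exists_hasCoeffDerivWithinAt_of_isOrthonormalFor horth hl hmoment (n + 1)
  refine ⟨d, hd, ?_⟩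
  simpa only [leadingCoeff, (hP l t h).natDegree_eq] using
    coeffDeriv_eq_C_mul_add_C_mul horth hl (uniqueDiffOn_Ici 0 l hl) hmoment hd

theorem coeff_mul_left_mul_right (hD : IsRelOpenCone D)
    (hP : ∀ l t, (l, t) ∈ D → IsOrthonormalWeight (volume.restrict (Ioi 0))
      (laplaceWeight α φ l t) (fun n => P n l t))
    (h : (l, t) ∈ D) {c : ℝ} (hc : 0 < c) (n k : ℕ) :
    (P n (c * l) (c * t)).coeff k = c ^ ((α + 1) / 2 + k) * (P n l t).coeff k :=
  (hP l t h).coeff_eq_rpow_mul (hP _ _ (hD.smul_mem c hc _ h)) hc n k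

theorem exists_hasCoeffDerivWithinAt_right (hD : IsRelOpenCone D)
    (hP : ∀ l t, (l, t) ∈ D → IsOrthonormalWeight (volume.restrict (Ioi 0))
      (laplaceWeight α φ l t) (fun n => P n l t))
    (h : (l, t) ∈ D) {n : ℕ} {d : ℝ[X]}
    (hd : HasCoeffDerivWithinAt (fun s => P n s t) d (Ici 0) l) :
    ∃ e, (0 < t → HasCoeffDerivWithinAt (fun s => P n l s) e univ t) ∧
      C t * e = C ((α + 1) / 2) * P n l t + X * derivative (P n l t) - C l * d := by
  have hl := hD.nonneg_left h
  have hcoeff : ∀ k, (C ((α + 1) / 2) * P n l t + X * derivative (P n l t) - C l * d).coeff k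
      = ((α + 1) / 2 + k) * (P n l t).coeff k - l * d.coeff k := fun k => by
    simp only [coeff_sub, coeff_add, coeff_C_mul, coeff_X_mul_derivative]
    ring
  rcases (hD.nonneg_right h).eq_or_lt with rfl | ht
  · refine ⟨0, fun h0 => absurd h0 (lt_irrefl 0), ?_⟩
    ext k
    have heuler := mul_deriv_eq_of_homogeneous hl (fun c hc => by
      simpa only [mul_zero] using coeff_mul_left_mul_right hD hP h hc n k) (hd.coeff k)
    rw [mul_zero, coeff_zero, hcoeff, heuler, sub_self]
  · refine ⟨C t⁻¹ * (C ((α + 1) / 2) * P n l t + X * derivative (P n l t) - C l * d),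
      fun _ => ⟨⟨n, ?_⟩, fun k => ?_⟩, ?_⟩
    · filter_upwards [nhdsWithin_le_nhds (hD.eventually_right h ht)] with s hs
        using ((hP l s hs).natDegree_eq n).le
    · rw [coeff_C_mul, hcoeff]
      refine (hasDerivAt_right_of_homogeneous (f := fun l t => (P n l t).coeff k) hl ht ?_
        (hd.coeff k)).hasDerivWithinAt
      filter_upwards [hD.eventually_right h ht] with s hs c hc
        using coeff_mul_left_mul_right hD hP hs hc n k
    · rw [← mul_assoc, ← C_mul, mul_inv_cancel₀ ht.ne', C_1, one_mul]

end Family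

theorem theorem2_general {α : ℝ} {φ : ℝ → ℝ} {D : Set (ℝ × ℝ)} (hD : IsRelOpenCone D)
    {P : ℕ → ℝ → ℝ → ℝ[X]}
    (hP : ∀ l t, (l, t) ∈ D → IsOrthonormalWeight (volume.restrict (Ioi 0))
      (laplaceWeight α φ l t) (fun n => P n l t))
    {a : ℕ → ℝ → ℝ → ℝ} (ha : ∀ n l t, a n l t = (P n l t).leadingCoeff)
    {A : ℕ → ℝ → ℝ → ℝ} (hA : ∀ n l t, A n l t = a (n - 1) l t / a n l t)
    {n : ℕ} (hn : 1 ≤ n) {l t : ℝ} (h : (l, t) ∈ D) :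
    (DifferentiableWithinAt ℝ (fun s => a n s t) (Ici 0) l ∧
      (∀ x : ℝ, DifferentiableWithinAt ℝ (fun s => (P n s t).eval x) (Ici 0) l)) ∧
    (0 < t → DifferentiableAt ℝ (fun s => a n l s) t ∧
      (∀ x : ℝ, DifferentiableAt ℝ (fun s => (P n l s).eval x) t)) ∧
    (∀ x : ℝ,
      derivWithin (fun s => (P n s t).eval x) (Ici 0) l
        - 1 / a n l t * derivWithin (fun s => a n s t) (Ici 0) l * (P n l t).eval x
        - A n l t * (P (n - 1) l t).eval x = 0) ∧
    (∀ x : ℝ,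
      (t * derivWithin (fun s => (P n l s).eval x) (Ici 0) t - x * (derivative (P n l t)).eval x)
        - (t / a n l t * derivWithin (fun s => a n l s) (Ici 0) t - n) * (P n l t).eval x
        + l * A n l t * (P (n - 1) l t).eval x = 0) := by
  obtain ⟨k, rfl⟩ := Nat.exists_eq_add_of_le' hn
  have hl := hD.nonneg_left h
  have horth := hP l t h
  obtain ⟨d, hd, hd_eq⟩ := exists_hasCoeffDerivWithinAt_left hD hP h k
  obtain ⟨e, he, he_eq⟩ := exists_hasCoeffDerivWithinAt_right hD hP h hd
  have he_expand := C_mul_eq_of_euler (horth.natDegree_eq (k + 1))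
    (leadingCoeff_ne_zero.1 (horth.leadingCoeff_pos (k + 1)).ne') hd_eq he_eq
  have hPl := hd.hasDerivWithinAt_eval hl
  have hPt := fun ht x => ((he ht).hasDerivWithinAt_eval (mem_univ t) x).hasDerivAt univ_mem
  have hal := hd.hasDerivWithinAt_leadingCoeff hl
    ((hD.eventually_left h).mono fun s hs => (hP s t hs).natDegree_eq (k + 1))
  have hat := fun ht => ((he ht).hasDerivWithinAt_leadingCoeff (mem_univ t) (nhdsWithin_le_nhds
    ((hD.eventually_right h ht).mono fun s hs => (hP l s hs).natDegree_eq (k + 1)))).hasDerivAt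
      univ_mem
  have hl_unique := uniqueDiffOn_Ici (0 : ℝ) l hl
  simp only [hA, ha, Nat.add_sub_cancel]
  refine ⟨⟨hal.differentiableWithinAt, fun x => (hPl x).differentiableWithinAt⟩,
    fun ht => ⟨(hat ht).differentiableAt, fun x => (hPt ht x).differentiableAt⟩,
    fun x => ?_, fun x => ?_⟩
  · have hd_eval := congrArg (eval x) hd_eq
    simp only [eval_add, eval_mul, eval_C] at hd_eval
    rw [(hPl x).derivWithin hl_unique, hal.derivWithin hl_unique]
    linear_combination hd_eval
  · have he_eval := congrArg (eval x) he_expand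
    simp only [eval_add, eval_sub, eval_mul, eval_C, eval_X] at he_eval
    have ht := hD.nonneg_right h
    rw [mul_derivWithin_Ici_eq_mul ht fun ht => hPt ht x, div_mul_eq_mul_div,
      mul_derivWithin_Ici_eq_mul ht hat]
    linear_combination he_eval

theorem isRelOpenCone_setOf_admissible (ν : ℝ) :
    IsRelOpenCone {z | Admissible ν z.1 z.2} where
  subset_Ici _ hz := ⟨hz.1, hz.2.1⟩
  mem_nhdsWithin := by
    rintro ⟨l, t⟩ ⟨-, -, hne, hν⟩
    have hsq : ∀ᶠ z : ℝ × ℝ in 𝓝[Ici 0] (l, t), z.1 ^ 2 + z.2 ^ 2 ≠ 0 :=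
      ((by fun_prop : Continuous fun z : ℝ × ℝ => z.1 ^ 2 + z.2 ^ 2).continuousWithinAt
        ).eventually_ne hne
    have hzero : ∀ᶠ z : ℝ × ℝ in 𝓝[Ici 0] (l, t), z.2 = 0 → 0 < ν := by
      rcases eq_or_ne t 0 with ht | ht
      · exact .of_forall fun _ _ => hν ht
      · filter_upwards [continuous_snd.continuousWithinAt.eventually_ne ht] with z hz h
        exact absurd h hz
    filter_upwards [self_mem_nhdsWithin, hsq, hzero] with z hz hz_ne hzν
    exact ⟨hz.1, hz.2, hz_ne, hzν⟩
  smul_mem := by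
    rintro c hc ⟨l, t⟩ ⟨hl, ht, hne, hν⟩
    refine ⟨mul_nonneg hc.le hl, mul_nonneg hc.le ht, ?_, fun h => hν ?_⟩
    · have hscale : (c * l) ^ 2 + (c * t) ^ 2 = c ^ 2 * (l ^ 2 + t ^ 2) := by ring
      exact hscale ▸ mul_ne_zero (pow_ne_zero 2 hc.ne') hne
    · exact (mul_eq_zero.1 h).resolve_left hc.ne'

theorem IsOrthonormalSeq.isOrthonormalWeight {α ν l t : ℝ} {p : ℕ → ℝ[X]}
    (h : IsOrthonormalSeq α ν l t p) :
    IsOrthonormalWeight (volume.restrict (Ioi 0)) (laplaceWeight α (rho ν) l t) p :=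
  ⟨h.natDegree_eq, h.leadingCoeff_pos, h.integrable, h.integral_eq⟩

theorem theorem2 (α ν : ℝ) (hα : -1 < α) (hν : 0 ≤ ν)
    -- `P n l t` is the polynomial `P_n(·; λ, t)`, and `a n l t` is its leading coefficient
    (P : ℕ → ℝ → ℝ → ℝ[X])
    (hP : ∀ l t : ℝ, Admissible ν l t → IsOrthonormalSeq α ν l t (fun n => P n l t))
    (a : ℕ → ℝ → ℝ → ℝ) (ha : ∀ n l t, a n l t = (P n l t).leadingCoeff)
    (A : ℕ → ℝ → ℝ → ℝ) (hA : ∀ n l t, A n l t = a (n - 1) l t / a n l t)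
    (n : ℕ) (hn : 1 ≤ n) (l t : ℝ) (hlt : Admissible ν l t) :
    -- the derivatives exist (one-sided in `λ` at `λ = 0`)
    (DifferentiableWithinAt ℝ (fun s => a n s t) (Ici 0) l ∧
      (∀ x : ℝ, DifferentiableWithinAt ℝ (fun s => (P n s t).eval x) (Ici 0) l)) ∧
    (0 < t → DifferentiableAt ℝ (fun s => a n l s) t ∧
      (∀ x : ℝ, DifferentiableAt ℝ (fun s => (P n l s).eval x) t)) ∧
    -- the equation in `λ`
    (∀ x : ℝ,
      derivWithin (fun s => (P n s t).eval x) (Ici 0) l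
        - 1 / a n l t * derivWithin (fun s => a n s t) (Ici 0) l * (P n l t).eval x
        - A n l t * (P (n - 1) l t).eval x = 0) ∧
    -- the equation in `t`; for `t = 0` the terms with the factor `t` vanish
    (∀ x : ℝ,
      (t * derivWithin (fun s => (P n l s).eval x) (Ici 0) t - x * (derivative (P n l t)).eval x)
        - (t / a n l t * derivWithin (fun s => a n l s) (Ici 0) t - n) * (P n l t).eval x
        + l * A n l t * (P (n - 1) l t).eval x = 0) :=
  theorem2_general (isRelOpenCone_setOf_admissible ν)
    (fun l t h => (hP l t h).isOrthonormalWeight) ha hA hn hlt
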